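/- Let $\Theta$ be a finite set of states with $|\Theta|=K\ge 2$, let $\Delta(\Theta)$ be the simplex of beliefs on $\Theta$, let $T\ge 2$ be the horizon, let $\pi_0\in\Delta(\Theta)$ be a prior with $\pi_0(\theta)>0$ for all $\theta$, and let $N:\Delta(\Theta)\times\Delta(\Theta)\to\mathbb{R}$, $(p,x)\mapsto N(p\mid x)$, be continuous. An information structure $(M,\sigma)$ consists of a finite message space $M$ and a strategy $\sigma=(\sigma_t)_{t=1}^{T-1}$, where $\sigma_t(\cdot\mid h^{t-1},\theta)\in\Delta(M)$ is the distribution of the period-$t$ message given the history $h^{t-1}\in M^{t-1}$ of past messages and the state $\theta$. The state is drawn from $\pi_0$; for $1\le t\le T-1$, $\pi_t$ is the Bayesian posterior belief after the on-path (i.e. positive-probability) history $h^t$, and in period $T$ the state is revealed, so that $\pi_T=1_\theta$, the point mass at the true state $\theta$. The expected news utility of $(M,\sigma)$ is $\mathbb{E}\big[\sum_{t=1}^{T}N(\pi_t\mid\pi_{t-1})\big]$. For $f:\Delta(\Theta)\to\mathbb{R}$ bounded above, let $\mathrm{cav} f$ be the smallest concave function on $\Delta(\Theta)$ that dominates $f$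 pointwise. Define $$U_{T-1}(p\mid x):=N(p\mid x)+\sum_{\theta\in\Theta}p(\theta)\,N(1_\theta\mid p),\qquad U^*_{T-1}(x):=\big(\mathrm{cav}\,U_{T-1}(\cdot\mid x)\big)(x),$$ and, backward for $t=T-2,\dots,1$, $$U_t(p\mid x):=N(p\mid x)+U^*_{t+1}(p),\qquad U^*_t(x):=\big(\mathrm{cav}\,U_t(\cdot\mid x)\big)(x).$$ Then the maximum of the expected news utility over all information structures exists and equals $U^*_1(\pi_0)$. Moreover, there is an information structure $(M,\sigma)$ with $|M|=K$ that attains this maximum and has the following property: for every $1\le t\le T-1$ and every on-path history $h^{t-1}$, with associated belief $\pi_{t-1}$, there are $q^1,\dots,q^K\in\Delta(\Theta)$ and $w^1,\dots,w^K\ge 0$ with $\sum_{k=1}^K w^k=1$, $\sum_{k=1}^K w^kq^k=\pi_{t-1}$ and $$U^*_t(\pi_{t-1})=\sum_{k=1}^K w^k\,U_t(q^k\mid\pi_{t-1}),$$ such that, conditional on $h^{t-1}$, the strategy $\sigma_t$ induces the posterior $q^k$ at the end of period $t$ with probability $w^k$; that is, conditional on $h^{t-1}$, the belief $\pi_t$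 has distribution $\sum_{k=1}^K w^k\delta_{q^k}$. -/

import Mathlib

open scoped BigOperators

noncomputable section

namespace NewsUtility

/-- Beliefs over the finite state space `Θ`, i.e. the simplex `Δ(Θ)`. -/
abbrev Belief (Θ : Type*) [Fintype Θ] : Type _ := stdSimplex ℝ Θ

/-- The concavification `cav f` of `f : Δ(Θ) → ℝ`: the smallest concave function on `Δ(Θ)` that
dominates `f` pointwise, i.e. the pointwise infimum of all concave functions that dominate `f`. -/
def cav {Θ : Type*} [Fintype Θ] (f : Belief Θ → ℝ) (x : Belief Θ) : ℝ :=
  sInf {y : ℝ | ∃ g : (Θ → ℝ) → ℝ, ConcaveOn ℝ (stdSimplex ℝ Θ) g ∧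
    (∀ p : Belief Θ, f p ≤ g (p : Θ → ℝ)) ∧ y = g (x : Θ → ℝ)}

section Backward

variable {Θ : Type*} [Fintype Θ]

open Classical in
/-- The expected news utility of the final period, in which the state is revealed to a receiver who
holds belief `x`: `∑ θ, x(θ) N(1_θ ∣ x)`. Here `N p x` stands for `N(p ∣ x)`. -/
def terminalValue (N : Belief Θ → Belief Θ → ℝ) (x : Belief Θ) : ℝ :=
  ∑ θ, x θ * N (stdSimplex.vertex θ) x

/-- The iterated concavification, indexed by the number of remaining communication periods. -/
def iterCav (N : Belief Θ → Belief Θ → ℝ) : ℕ → Belief Θ → ℝ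
  | 0 => terminalValue N
  | n + 1 => fun x => cav (fun p => N p x + iterCav N n p) x

/-- `U*_t` with horizon `T`, for `1 ≤ t ≤ T - 1`; by convention `U*_T` is the expected news utility
of the final period. -/
def Ustar (N : Belief Θ → Belief Θ → ℝ) (T t : ℕ) : Belief Θ → ℝ := iterCav N (T - t)

/-- `U_t(p ∣ x) = N(p ∣ x) + U*_{t+1}(p)` with horizon `T`, for `1 ≤ t ≤ T - 1`. -/
def U (N : Belief Θ → Belief Θ → ℝ) (T t : ℕ) (p x : Belief Θ) : ℝ :=
  N p x + Ustar N T (t + 1) p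

/-- The last communication period:
`U_{T-1}(p ∣ x) = N(p ∣ x) + ∑ θ, p(θ) N(1_θ ∣ p)`. -/
theorem U_last (N : Belief Θ → Belief Θ → ℝ) {T : ℕ} (hT : 2 ≤ T) (p x : Belief Θ) :
    U N T (T - 1) p x = N p x + terminalValue N p := by
  have h : T - (T - 1 + 1) = 0 := by omega
  simp [U, Ustar, h, iterCav]

/-- The recursion `U*_t(x) = (cav U_t(· ∣ x))(x)` for `1 ≤ t ≤ T - 1`. -/
theorem Ustar_eq_cav (N : Belief Θ → Belief Θ → ℝ) {T t : ℕ} (ht : t < T) (x : Belief Θ) :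
    Ustar N T t x = cav (fun p => U N T t p x) x := by
  have h : T - t = (T - (t + 1)) + 1 := by omega
  simp only [U, Ustar]
  rw [h]
  rfl

end Backward

/-- An information structure `(M, σ)`: a finite message space `M` and a strategy. A public history
of `t` messages is a function `h : Fin t → M`, and `σ t h θ` is the distribution of the message of
period `t + 1` after the history `h` in state `θ`. With horizon `T`, only the components
`σ 0, …, σ (T - 2)`, which govern the communication periods `1, …, T - 1`, are ever used. -/
structure InfoStructure (Θ : Type*) where
  /-- the message space -/
  M : Type
  /-- the message space is finite -/
  fintypeM : Fintype M
  /-- the strategy of the sender -/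
  σ : (t : ℕ) → (Fin t → M) → Θ → stdSimplex ℝ M

attribute [instance] InfoStructure.fintypeM

namespace InfoStructure

/-- The first `i` messages of a history. -/
def pre {M : Type} {t : ℕ} (h : Fin t → M) (i : ℕ) (hi : i ≤ t) : Fin i → M :=
  fun j => h (Fin.castLE hi j)

/-- The history `h` followed by the message `m`. -/
def append {M : Type} {t : ℕ} (h : Fin t → M) (m : M) : Fin (t + 1) → M :=
  Fin.snoc (α := fun _ => M) h m

/-- The probability of the history `h` conditional on the state `θ`. -/
def lik {Θ : Type*} (S : InfoStructure Θ) {t : ℕ} (h : Fin t → S.M) (θ : Θ) : ℝ :=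
  ∏ i : Fin t, S.σ i (pre h i i.isLt.le) θ (h i)

theorem lik_nonneg {Θ : Type*} (S : InfoStructure Θ) {t : ℕ} (h : Fin t → S.M) (θ : Θ) :
    0 ≤ S.lik h θ :=
  Finset.prod_nonneg fun _ _ => stdSimplex.zero_le _ _

variable {Θ : Type*} [Fintype Θ] (S : InfoStructure Θ)

/-- The probability of the history `h` under the prior `π₀`. The history is on-path if this is
positive. -/
def prob (π₀ : Belief Θ) {t : ℕ} (h : Fin t → S.M) : ℝ :=
  ∑ θ, π₀ θ * S.lik h θ

open Classical in
/-- The Bayesian posterior belief `π_t` after the on-path history `h` of `t` messages. After a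
history of probability zero it is set to the prior; such histories carry no weight below. -/
def posterior (π₀ : Belief Θ) {t : ℕ} (h : Fin t → S.M) : Belief Θ :=
  if hp : 0 < S.prob π₀ h then
    ⟨fun θ => π₀ θ * S.lik h θ / S.prob π₀ h,
      fun θ => div_nonneg (mul_nonneg (stdSimplex.zero_le _ _) (S.lik_nonneg h θ)) hp.le, by
        rw [← Finset.sum_div]
        exact div_self hp.ne'⟩
  else π₀

open Classical in
/-- The expected news utility `E[∑_{t=1}^{T} N(π_t ∣ π_{t-1})]` of the information structure, where
`π_t` is the Bayesian posterior for `t ≤ T - 1` and `π_T = 1_θ` in state `θ`. -/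
def expectedNewsUtility (N : Belief Θ → Belief Θ → ℝ) (T : ℕ) (π₀ : Belief Θ) : ℝ :=
  ∑ θ, ∑ h : Fin (T - 1) → S.M, π₀ θ * S.lik h θ *
    ((∑ i : Fin (T - 1), N (S.posterior π₀ (pre h (i + 1) i.isLt))
        (S.posterior π₀ (pre h i i.isLt.le)))
      + N (stdSimplex.vertex θ) (S.posterior π₀ h))

open Classical in
/-- The probability, conditional on the on-path history `h` of `t` messages, that the posterior
belief at the end of period `t + 1` equals `p`. -/
def condProbPosterior (π₀ : Belief Θ) {t : ℕ} (h : Fin t → S.M) (p : Belief Θ) : ℝ :=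
  ∑ m : S.M, if S.posterior π₀ (append h m) = p then S.prob π₀ (append h m) / S.prob π₀ h else 0

end InfoStructure

end NewsUtility

end

/-!
The proof is dynamic programming over beliefs, resting on two facts.

*Concavification.* For upper semicontinuous `f`, `cav f x` is the largest average
`∑ w k * f (q k)` over the ways of splitting `x` into finitely many beliefs `q k`, and it is attained
by a splitting into `|Θ|` beliefs (`exists_split_eq_cav`, `IsSplit.average_le_cav`). The bound `|Θ|`,
one less than Carathéodory's theorem in the space containing the hypograph would give, comes from
linear dependence: more than `|Θ|` vectors of `Θ → ℝ` are dependent, and shifting weight along a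
dependency in the favourable direction removes one of them (`IsSplit.exists_card`). With the number
of beliefs bounded, existence of a maximizer is compactness, and the value as a function of the belief
is a concave majorant of `f`, hence equal to `cav f`. The functions `iterCav N n` need not be
continuous a priori, but upper semicontinuity suffices and passes through the recursion
(`upperSemicontinuous_cav`).

*Bayes plausibility.* In any information structure the next posterior splits the current one
(`isSplit_posterior`), so a period earns at most what the concavification allows, and replacing
realized play by the continuation value one period at a time bounds the expected news utility by
`Ustar N T 1 π₀` (`hybridValue_succ_le`). Conversely, any rule assigning to each period and belief a
splitting into `|Θ|` beliefs is realized by an information structure with `|Θ|` messages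
(`splitStructure`); for optimal splittings every inequality becomes an equality.
-/

namespace NewsUtility

/-! ### Splittings of a belief -/

/-- The weights `w` and beliefs `q` split the belief `x`: the weights are nonnegative and `x` is the
average of the `q k`. Since beliefs have total mass one, the weights then sum to one
(`IsSplit.sum_eq_one`). -/
structure IsSplit {Θ ι : Type*} [Fintype Θ] [Fintype ι] (w : ι → ℝ) (q : ι → Belief Θ)
    (x : Θ → ℝ) : Prop where
  nonneg : ∀ k, 0 ≤ w k
  average : ∀ θ, ∑ k, w k * q k θ = x θ

variable {Θ : Type*} [Fintype Θ]

theorem IsSplit.sum_eq_one {ι : Type*} [Fintype ι] {w : ι → ℝ} {q : ι → Belief Θ} {x : Belief Θ}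
    (h : IsSplit w q x) : ∑ k, w k = 1 := by
  calc ∑ k, w k = ∑ k, w k * ∑ θ, q k θ := by simp
    _ = ∑ θ, ∑ k, w k * q k θ := by
      simp_rw [Finset.mul_sum]
      exact Finset.sum_comm
    _ = 1 := by simp_rw [h.average]; exact stdSimplex.sum_eq_one x

/-- One pivoting step. More than `|Θ|` beliefs are linearly dependent; moving the weights along a
dependency, in the direction that does not lower the average of `f`, until the first of them
vanishes keeps the average belief and shrinks the support. -/
theorem exists_smaller_support {ι : Type*} [Fintype ι] (q : ι → Belief Θ) (f : ι → ℝ)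
    (w : ι → ℝ) (hw : ∀ k, 0 ≤ w k)
    (hcard : Fintype.card Θ < (Finset.univ.filter fun k => w k ≠ 0).card) :
    ∃ w' : ι → ℝ, (∀ k, 0 ≤ w' k) ∧ (∀ θ, ∑ k, w' k * q k θ = ∑ k, w k * q k θ) ∧
      ∑ k, w k * f k ≤ ∑ k, w' k * f k ∧
      (Finset.univ.filter fun k => w' k ≠ 0).card < (Finset.univ.filter fun k => w k ≠ 0).card := by
  classical
  set s : Finset ι := Finset.univ.filter fun k => w k ≠ 0 with hs
  have hdep : ¬ LinearIndepOn ℝ (fun k => (q k : Θ → ℝ)) (s : Set ι) := by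
    intro hli
    have := LinearIndependent.fintype_card_le_finrank hli
    simp at this
    omega
  obtain ⟨c, hc, hcf, hcs, i, hi⟩ : ∃ c : ι → ℝ, (∀ θ, ∑ k, c k * q k θ = 0) ∧
      0 ≤ ∑ k, c k * f k ∧ (∀ k ∉ s, c k = 0) ∧ ∃ k, c k ≠ 0 := by
    rw [not_linearIndepOn_finset_iff] at hdep
    obtain ⟨c, hc, i, his, hi⟩ := hdep
    set d : ι → ℝ := fun k => if k ∈ s then c k else 0 with hd
    have hdq : ∀ θ, ∑ k, d k * q k θ = 0 := by
      intro θ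
      have h := congrFun hc θ
      simpa [hd, ite_mul, Finset.sum_apply] using h
    have hds : ∀ k ∉ s, d k = 0 := fun k hk => by simp [hd, hk]
    have hdi : d i ≠ 0 := by simpa [hd, his] using hi
    rcases le_total 0 (∑ k, d k * f k) with h0 | h0
    · exact ⟨d, hdq, h0, hds, i, hdi⟩
    · refine ⟨fun k => - d k, fun θ => ?_, ?_, fun k hk => ?_, i, ?_⟩
      · simp [hdq θ]
      · simpa using h0
      · simp [hds k hk]
      · simpa using hdi
  have hsum : ∑ k, c k = 0 := by
    calc ∑ k, c k = ∑ k, c k * ∑ θ, q k θ := by simp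
      _ = ∑ θ, ∑ k, c k * q k θ := by
        simp_rw [Finset.mul_sum]
        exact Finset.sum_comm
      _ = 0 := by simp [hc]
  have hneg : (Finset.univ.filter fun k => c k < 0).Nonempty := by
    by_contra hne
    rw [Finset.not_nonempty_iff_eq_empty, Finset.filter_eq_empty_iff] at hne
    have h0 : ∀ k, 0 ≤ c k := fun k => not_lt.1 (hne (Finset.mem_univ k))
    exact hi ((Finset.sum_eq_zero_iff_of_nonneg fun k _ => h0 k).1 hsum i (Finset.mem_univ i))
  obtain ⟨j, hj, hmin⟩ := Finset.exists_min_image _ (fun k => w k / (-c k)) hneg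
  have hcj : c j < 0 := by simpa using hj
  set t := w j / (-c j) with ht
  have ht0 : 0 ≤ t := div_nonneg (hw j) (by linarith)
  have hjs : j ∈ s := by
    by_contra h
    exact hcj.ne (hcs j h)
  have hwj : w j + t * c j = 0 := by
    rw [ht, div_neg, neg_mul, div_mul_cancel₀ _ hcj.ne, add_neg_cancel]
  refine ⟨fun k => w k + t * c k, fun k => ?_, fun θ => ?_, ?_, ?_⟩
  · rcases lt_or_ge (c k) 0 with hk | hk
    · have h := hmin k (by simpa using hk)
      rw [le_div_iff₀ (by linarith)] at h
      linarith
    · have := mul_nonneg ht0 hk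
      have := hw k
      linarith
  · simp_rw [add_mul, Finset.sum_add_distrib, mul_assoc, ← Finset.mul_sum, hc]
    simp
  · simp_rw [add_mul, Finset.sum_add_distrib, mul_assoc, ← Finset.mul_sum]
    have := mul_nonneg ht0 hcf
    linarith
  · refine Finset.card_lt_card ((Finset.ssubset_iff_of_subset fun k hk => ?_).2 ⟨j, hjs, ?_⟩)
    · by_contra h
      have hwk : w k = 0 := by simpa [hs] using h
      simp [hwk, hcs k h] at hk
    · simp [hwj]

theorem exists_support_card_le {ι : Type*} [Fintype ι] (q : ι → Belief Θ) (f : ι → ℝ)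
    (w : ι → ℝ) (hw : ∀ k, 0 ≤ w k) :
    ∃ w' : ι → ℝ, (∀ k, 0 ≤ w' k) ∧ (∀ θ, ∑ k, w' k * q k θ = ∑ k, w k * q k θ) ∧
      ∑ k, w k * f k ≤ ∑ k, w' k * f k ∧
      (Finset.univ.filter fun k => w' k ≠ 0).card ≤ Fintype.card Θ := by
  induction hn : (Finset.univ.filter fun k => w k ≠ 0).card using Nat.strong_induction_on
    generalizing w with
  | _ n ih =>
    rcases le_or_gt n (Fintype.card Θ) with h | h
    · exact ⟨w, hw, fun _ => rfl, le_rfl, hn ▸ h⟩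
    · obtain ⟨v, hv, hvq, hvf, hlt⟩ := exists_smaller_support q f w hw (hn ▸ h)
      obtain ⟨u, hu, huq, huf, hle⟩ := ih _ (hn ▸ hlt) v hv rfl
      exact ⟨u, hu, fun θ => (huq θ).trans (hvq θ), hvf.trans huf, hle⟩

/-- Every splitting can be replaced by one into `|Θ|` beliefs, without lowering the average of
`f`. -/
theorem IsSplit.exists_card {ι : Type*} [Fintype ι] {w : ι → ℝ} {q : ι → Belief Θ} {x : Belief Θ}
    (h : IsSplit w q x) (f : Belief Θ → ℝ) :
    ∃ (w' : Fin (Fintype.card Θ) → ℝ) (q' : Fin (Fintype.card Θ) → Belief Θ),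
      IsSplit w' q' x ∧ ∑ k, w k * f (q k) ≤ ∑ k, w' k * f (q' k) := by
  classical
  obtain ⟨v, hv, hvq, hvf, hcard⟩ := exists_support_card_le q (fun k => f (q k)) w h.nonneg
  obtain ⟨e⟩ : Nonempty ({k // v k ≠ 0} ↪ Fin (Fintype.card Θ)) :=
    Function.Embedding.nonempty_of_card_le (by simpa [Fintype.card_subtype] using hcard)
  set w' : Fin (Fintype.card Θ) → ℝ := Function.extend e (fun k => v k) 0 with hw'
  set q' : Fin (Fintype.card Θ) → Belief Θ := Function.extend e (fun k => q k) (fun _ => x) with hq'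
  have key : ∀ g : Belief Θ → ℝ, ∑ k, w' k * g (q' k) = ∑ k, v k * g (q k) := by
    intro g
    trans ∑ k : {k // v k ≠ 0}, v k * g (q k)
    · refine (Fintype.sum_of_injective e e.injective _ _ (fun i hi => ?_) fun k => ?_).symm
      · rw [hw', Function.extend_apply' _ _ _ (by simpa using hi)]
        simp
      · rw [hw', hq', e.injective.extend_apply, e.injective.extend_apply]
    · refine Fintype.sum_of_injective Subtype.val Subtype.val_injective _ _ (fun i hi => ?_)
        fun k => rfl
      have : v i = 0 := by simpa using hi
      simp [this]
  refine ⟨w', q', ⟨fun k => ?_, fun θ => ?_⟩, ?_⟩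
  · by_cases hk : ∃ i, e i = k
    · obtain ⟨i, rfl⟩ := hk
      rw [hw', e.injective.extend_apply]
      exact hv _
    · rw [hw', Function.extend_apply' _ _ _ hk]
      simp
  · rw [key fun p => p θ, hvq, h.average]
  · rw [key f]
    exact hvf

/-! ### The concavification of an upper semicontinuous function -/

open Topology Filter in
theorem upperSemicontinuous_mul_of_nonneg {α : Type*} [TopologicalSpace α] {w f : α → ℝ}
    (hw : Continuous w) (hw0 : ∀ a, 0 ≤ w a) (hf : UpperSemicontinuous f) :
    UpperSemicontinuous fun a => w a * f a := by
  intro a c hc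
  -- bound `f` near `a` by a constant `d > f a` with `w a * d < c`
  obtain ⟨d, hd, hdc⟩ : ∃ d, f a < d ∧ w a * d < c := by
    have h1 : Tendsto (fun d => w a * d) (𝓝[>] f a) (𝓝 (w a * f a)) :=
      ((continuous_const.mul continuous_id).tendsto (f a)).mono_left nhdsWithin_le_nhds
    exact ((eventually_mem_nhdsWithin).and (h1.eventually_lt_const hc)).exists
  have h2 : ∀ᶠ b in 𝓝 a, w b * d < c :=
    ((hw.mul continuous_const).tendsto a).eventually_lt_const hdc
  filter_upwards [h2, hf a d hd] with b hb hb'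
  exact (mul_le_mul_of_nonneg_left hb'.le (hw0 b)).trans_lt hb

/-- The average of the beliefs `q k` with weights `w`. -/
def barycenter {ι : Type*} [Fintype ι] (w : stdSimplex ℝ ι) (q : ι → Belief Θ) : Belief Θ :=
  ⟨fun θ => ∑ k, w k * q k θ,
    fun θ => Finset.sum_nonneg fun k _ =>
      mul_nonneg (stdSimplex.zero_le w k) (stdSimplex.zero_le (q k) θ), by
    rw [Finset.sum_comm]
    simp_rw [← Finset.mul_sum, stdSimplex.sum_eq_one, mul_one]
    exact stdSimplex.sum_eq_one w⟩

theorem continuous_eval {ι : Type*} [Fintype ι] (k : ι) :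
    Continuous fun w : stdSimplex ℝ ι => w k :=
  (continuous_apply k).comp continuous_subtype_val

theorem continuous_barycenter {ι : Type*} [Fintype ι] :
    Continuous fun z : stdSimplex ℝ ι × (ι → Belief Θ) => barycenter z.1 z.2 := by
  refine Continuous.subtype_mk (continuous_pi fun θ => continuous_finsetSum _ fun k _ => ?_) _
  exact ((continuous_eval k).comp continuous_fst).mul
    ((continuous_eval θ).comp ((continuous_apply k).comp continuous_snd))

theorem isSplit_barycenter {ι : Type*} [Fintype ι] (w : stdSimplex ℝ ι) (q : ι → Belief Θ) :
    IsSplit w q (barycenter w q) :=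
  ⟨stdSimplex.zero_le w, fun _ => rfl⟩

theorem IsSplit.exists_barycenter {ι : Type*} [Fintype ι] {w : ι → ℝ} {q : ι → Belief Θ}
    {x : Belief Θ} (h : IsSplit w q x) : ∃ v : stdSimplex ℝ ι, ⇑v = w ∧ barycenter v q = x :=
  ⟨⟨w, h.nonneg, h.sum_eq_one⟩, rfl, stdSimplex.ext (funext h.average)⟩

theorem upperSemicontinuous_average {ι : Type*} [Fintype ι] {F : Belief Θ → Belief Θ → ℝ}
    (hF : UpperSemicontinuous fun z : Belief Θ × Belief Θ => F z.1 z.2) :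
    UpperSemicontinuous fun z : stdSimplex ℝ ι × (ι → Belief Θ) =>
      ∑ k, z.1 k * F (z.2 k) (barycenter z.1 z.2) := by
  refine upperSemicontinuous_sum fun k _ => upperSemicontinuous_mul_of_nonneg
    ((continuous_eval k).comp continuous_fst) (fun z => stdSimplex.zero_le z.1 k) ?_
  exact hF.comp (((continuous_apply k).comp continuous_snd).prodMk continuous_barycenter)

theorem isSplit_const (x : Belief Θ) : IsSplit (fun _ : Unit => (1 : ℝ)) (fun _ => x) x :=
  ⟨fun _ => zero_le_one, fun θ => by simp⟩

theorem exists_isSplit (x : Belief Θ) :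
    ∃ (w : Fin (Fintype.card Θ) → ℝ) (q : Fin (Fintype.card Θ) → Belief Θ), IsSplit w q x := by
  obtain ⟨w, q, h, -⟩ := (isSplit_const x).exists_card fun _ => 0
  exact ⟨w, q, h⟩

/-- Among the splittings of `x` into `|Θ|` beliefs, one maximizes the average of `f`: they form a
compact set on which the average is upper semicontinuous. By `IsSplit.exists_card` it also beats
all other splittings. -/
theorem exists_optimal_split {f : Belief Θ → ℝ} (hf : UpperSemicontinuous f) (x : Belief Θ) :
    ∃ (w : Fin (Fintype.card Θ) → ℝ) (q : Fin (Fintype.card Θ) → Belief Θ), IsSplit w q x ∧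
      ∀ {ι : Type} [Fintype ι] {w' : ι → ℝ} {q' : ι → Belief Θ}, IsSplit w' q' x →
        ∑ k, w' k * f (q' k) ≤ ∑ k, w k * f (q k) := by
  set A : Set (stdSimplex ℝ (Fin (Fintype.card Θ)) × (Fin (Fintype.card Θ) → Belief Θ)) :=
    {z | barycenter z.1 z.2 = x} with hA
  have hAc : IsCompact A := (isClosed_eq continuous_barycenter continuous_const).isCompact
  have hAn : A.Nonempty := by
    obtain ⟨w, q, h⟩ := exists_isSplit x
    obtain ⟨v, -, hv⟩ := h.exists_barycenter
    exact ⟨(v, q), hv⟩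
  have husc := upperSemicontinuous_average (ι := Fin (Fintype.card Θ)) (F := fun p _ => f p)
    (hf.comp continuous_fst)
  obtain ⟨z, hz, hmax⟩ := (husc.upperSemicontinuousOn A).exists_isMaxOn hAn hAc
  refine ⟨z.1, z.2, ?_, fun h => ?_⟩
  · have h := isSplit_barycenter z.1 z.2
    rwa [show barycenter z.1 z.2 = x from hz] at h
  · obtain ⟨w', q', h', hle⟩ := h.exists_card f
    obtain ⟨v, hvw, hv⟩ := h'.exists_barycenter
    have := hmax (show (v, q') ∈ A from hv)
    simp only [Set.mem_ofPred_eq, hvw] at this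
    exact hle.trans this

theorem IsSplit.combine {ι κ : Type*} [Fintype ι] [Fintype κ] {w : ι → ℝ} {q : ι → Belief Θ}
    {v : κ → ℝ} {r : κ → Belief Θ} {x y : Θ → ℝ} (hx : IsSplit w q x) (hy : IsSplit v r y)
    {a b : ℝ} (ha : 0 ≤ a) (hb : 0 ≤ b) :
    IsSplit (Sum.elim (fun k => a * w k) fun k => b * v k) (Sum.elim q r) (a • x + b • y) := by
  refine ⟨?_, fun θ => ?_⟩
  · rintro (k | k)
    · exact mul_nonneg ha (hx.nonneg k)
    · exact mul_nonneg hb (hy.nonneg k)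
  · simp [mul_assoc, ← Finset.mul_sum, hx.average, hy.average]

theorem average_le_of_concaveOn {g : (Θ → ℝ) → ℝ} (hg : ConcaveOn ℝ (stdSimplex ℝ Θ) g)
    {ι : Type*} [Fintype ι] {w : ι → ℝ} {q : ι → Belief Θ} {x : Belief Θ} (h : IsSplit w q x) :
    ∑ k, w k * g (q k) ≤ g x := by
  have hj := hg.le_map_sum (t := Finset.univ) (w := w) (p := fun k => (q k : Θ → ℝ))
    (fun k _ => h.nonneg k) h.sum_eq_one fun k _ => (q k).2
  have hx : ∑ k, w k • (q k : Θ → ℝ) = x := by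
    ext θ
    rw [Finset.sum_apply]
    exact h.average θ
  rw [hx] at hj
  simpa using hj

/-- The value of the concavification is the best average over splittings. Every concave majorant
exceeds all averages; conversely, the best average is a concave majorant. -/
theorem cav_eq_of_isMax {f : Belief Θ → ℝ} (hf : UpperSemicontinuous f) {x : Belief Θ}
    {n : ℕ} {w : Fin n → ℝ} {q : Fin n → Belief Θ} (h : IsSplit w q x)
    (hmax : ∀ {ι : Type} [Fintype ι] {w' : ι → ℝ} {q' : ι → Belief Θ}, IsSplit w' q' x →
        ∑ k, w' k * f (q' k) ≤ ∑ k, w k * f (q k)) :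
    cav f x = ∑ k, w k * f (q k) := by
  choose W Q hWQ hbest using fun y : Belief Θ => exists_optimal_split hf y
  -- the best average over splittings, as a function of the belief, is itself a concave majorant
  set V : Belief Θ → ℝ := fun y => ∑ k, W y k * f (Q y k) with hV
  classical
  set g : (Θ → ℝ) → ℝ := fun y => if hy : y ∈ stdSimplex ℝ Θ then V ⟨y, hy⟩ else 0 with hg
  have hgV : ∀ y (hy : y ∈ stdSimplex ℝ Θ), g y = V ⟨y, hy⟩ := fun y hy => dif_pos hy
  have hconc : ConcaveOn ℝ (stdSimplex ℝ Θ) g := by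
    refine ⟨convex_stdSimplex ℝ Θ, fun y hy z hz a b ha hb hab => ?_⟩
    have hyz := convex_stdSimplex ℝ Θ hy hz ha hb hab
    have hs := (hWQ ⟨y, hy⟩).combine (hWQ ⟨z, hz⟩) ha hb
    have := hbest ⟨_, hyz⟩ hs
    rw [hgV y hy, hgV z hz, hgV _ hyz]
    simpa [hV, mul_assoc, ← Finset.mul_sum] using this
  have hdom : ∀ p : Belief Θ, f p ≤ g p := fun p => by
    rw [hgV p p.2]
    change f p ≤ V p
    simpa [hV] using hbest p (isSplit_const p)
  have hlow : ∀ y ∈ {y : ℝ | ∃ g : (Θ → ℝ) → ℝ, ConcaveOn ℝ (stdSimplex ℝ Θ) g ∧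
      (∀ p : Belief Θ, f p ≤ g (p : Θ → ℝ)) ∧ y = g (x : Θ → ℝ)}, ∑ k, w k * f (q k) ≤ y := by
    rintro y ⟨g', hg', hdom', rfl⟩
    exact (Finset.sum_le_sum fun k _ => mul_le_mul_of_nonneg_left (hdom' _) (h.nonneg k)).trans
      (average_le_of_concaveOn hg' h)
  refine le_antisymm ((csInf_le ⟨_, hlow⟩ ⟨g, hconc, hdom, rfl⟩).trans ?_)
    (le_csInf ⟨_, g, hconc, hdom, rfl⟩ hlow)
  rw [hgV x x.2]
  exact hmax (hWQ x)

theorem exists_split_eq_cav {f : Belief Θ → ℝ} (hf : UpperSemicontinuous f) (x : Belief Θ) :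
    ∃ (w : Fin (Fintype.card Θ) → ℝ) (q : Fin (Fintype.card Θ) → Belief Θ), IsSplit w q x ∧
      cav f x = ∑ k, w k * f (q k) := by
  obtain ⟨w, q, h, hmax⟩ := exists_optimal_split hf x
  exact ⟨w, q, h, cav_eq_of_isMax hf h hmax⟩

theorem IsSplit.average_le_cav {f : Belief Θ → ℝ} (hf : UpperSemicontinuous f) {ι : Type}
    [Fintype ι] {w : ι → ℝ} {q : ι → Belief Θ} {x : Belief Θ} (h : IsSplit w q x) :
    ∑ k, w k * f (q k) ≤ cav f x := by
  obtain ⟨w', q', h', hmax⟩ := exists_optimal_split hf x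
  rw [cav_eq_of_isMax hf h' hmax]
  exact hmax h

/-- Concavifying `F(· ∣ x)` and evaluating at `x` preserves upper semicontinuity: the superlevel
set of the value at height `c` is the image, under the averaging map, of the compact set of
splittings whose average payoff is at least `c`. -/
theorem upperSemicontinuous_cav {F : Belief Θ → Belief Θ → ℝ}
    (hF : UpperSemicontinuous fun z : Belief Θ × Belief Θ => F z.1 z.2) :
    UpperSemicontinuous fun x => cav (fun p => F p x) x := by
  rw [upperSemicontinuous_iff_isClosed_preimage]
  intro c
  have hFx : ∀ x, UpperSemicontinuous fun p => F p x := fun x =>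
    hF.comp (continuous_id.prodMk continuous_const)
  have hcl := (upperSemicontinuous_average (ι := Fin (Fintype.card Θ)) hF).isClosed_preimage c
  convert (hcl.isCompact.image continuous_barycenter).isClosed using 1
  ext x
  simp only [Set.mem_preimage, Set.mem_Ici, Set.mem_image]
  constructor
  · intro hc
    obtain ⟨w, q, h, heq⟩ := exists_split_eq_cav (hFx x) x
    obtain ⟨v, hvw, hv⟩ := h.exists_barycenter
    refine ⟨(v, q), ?_, hv⟩
    rw [heq] at hc
    simpa [hv, hvw] using hc
  · rintro ⟨z, hz, rfl⟩
    exact hz.trans ((isSplit_barycenter z.1 z.2).average_le_cav (hFx _))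

theorem upperSemicontinuous_iterCav {N : Belief Θ → Belief Θ → ℝ}
    (hN : Continuous fun z : Belief Θ × Belief Θ => N z.1 z.2) (n : ℕ) :
    UpperSemicontinuous (iterCav N n) := by
  induction n with
  | zero =>
    refine Continuous.upperSemicontinuous (continuous_finsetSum _ fun θ _ => ?_)
    exact (continuous_eval θ).mul (hN.comp (continuous_const.prodMk continuous_id))
  | succ n ih => exact upperSemicontinuous_cav (hN.upperSemicontinuous.add (ih.comp continuous_fst))

theorem upperSemicontinuous_stage {N : Belief Θ → Belief Θ → ℝ}
    (hN : Continuous fun z : Belief Θ × Belief Θ => N z.1 z.2) (n : ℕ) (x : Belief Θ) :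
    UpperSemicontinuous fun p => N p x + iterCav N n p :=
  (hN.comp (continuous_id.prodMk continuous_const)).upperSemicontinuous.add
    (upperSemicontinuous_iterCav hN n)

open Finset

namespace InfoStructure

/-! ### Histories and Bayesian updating -/

section Histories

variable {M : Type}

theorem pre_append {t : ℕ} (h : Fin t → M) (m : M) (i : ℕ) (hi : i ≤ t) :
    pre (append h m) i (hi.trans t.le_succ) = pre h i hi := by
  funext j
  exact Fin.snoc_castSucc (α := fun _ => M) m h (Fin.castLE hi j)

theorem pre_self {t : ℕ} (h : Fin t → M) : pre h t le_rfl = h := rfl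

theorem append_last {t : ℕ} (h : Fin t → M) (m : M) : append h m (Fin.last t) = m :=
  Fin.snoc_last (α := fun _ => M) m h

theorem append_castSucc {t : ℕ} (h : Fin t → M) (m : M) (i : Fin t) :
    append h m i.castSucc = h i :=
  Fin.snoc_castSucc (α := fun _ => M) m h i

theorem append_pre_last {t : ℕ} (h : Fin (t + 1) → M) :
    append (pre h t t.le_succ) (h (Fin.last t)) = h :=
  Fin.snoc_init_self (α := fun _ => M) h

theorem sum_history_succ [Fintype M] {t : ℕ} (F : (Fin (t + 1) → M) → ℝ) :
    ∑ h, F h = ∑ h : Fin t → M, ∑ m, F (append h m) := by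
  rw [← (Fin.snocEquiv fun _ : Fin (t + 1) => M).sum_comp, Fintype.sum_prod_type, Finset.sum_comm]
  rfl

end Histories

theorem lik_append {Θ : Type*} (S : InfoStructure Θ) {t : ℕ} (h : Fin t → S.M) (m : S.M) (θ : Θ) :
    S.lik (append h m) θ = S.lik h θ * S.σ t h θ m := by
  unfold lik
  rw [Fin.prod_univ_castSucc]
  congr 1
  · refine Finset.prod_congr rfl fun i _ => ?_
    rw [append_castSucc]
    congr 2
    exact pre_append h m i i.isLt.le
  · rw [append_last]
    exact congrArg (fun k => S.σ t k θ m) (pre_append h m t le_rfl)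

variable {Θ : Type*} [Fintype Θ] (S : InfoStructure Θ) (π₀ : Belief Θ)

theorem prob_nonneg {t : ℕ} (h : Fin t → S.M) : 0 ≤ S.prob π₀ h :=
  sum_nonneg fun _ _ => mul_nonneg (stdSimplex.zero_le _ _) (S.lik_nonneg h _)

/-- Bayes' rule; off path both sides vanish. -/
theorem prob_mul_posterior {t : ℕ} (h : Fin t → S.M) (θ : Θ) :
    S.prob π₀ h * S.posterior π₀ h θ = π₀ θ * S.lik h θ := by
  by_cases hp : 0 < S.prob π₀ h
  · have : S.posterior π₀ h θ = π₀ θ * S.lik h θ / S.prob π₀ h := by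
      unfold posterior
      rw [dif_pos hp]
      rfl
    rw [this, mul_div_cancel₀ _ hp.ne']
  · have h0 : S.prob π₀ h = 0 := le_antisymm (not_lt.1 hp) (S.prob_nonneg π₀ h)
    rw [h0, zero_mul]
    exact ((sum_eq_zero_iff_of_nonneg fun θ _ =>
      mul_nonneg (stdSimplex.zero_le π₀ θ) (S.lik_nonneg h θ)).1 h0 θ (mem_univ θ)).symm

theorem sum_prob_append {t : ℕ} (h : Fin t → S.M) :
    ∑ m, S.prob π₀ (append h m) = S.prob π₀ h := by
  unfold prob
  rw [sum_comm]
  simp_rw [lik_append, ← mul_sum, stdSimplex.sum_eq_one, mul_one]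

theorem prob_zero (h : Fin 0 → S.M) : S.prob π₀ h = 1 := by
  simp [prob, lik]

theorem posterior_zero (h : Fin 0 → S.M) : S.posterior π₀ h = π₀ := by
  refine stdSimplex.ext (funext fun θ => ?_)
  have := S.prob_mul_posterior π₀ h θ
  simpa [prob_zero, lik] using this

/-- Bayes plausibility: the conditional distribution of the next posterior splits the current
one. -/
theorem isSplit_posterior {t : ℕ} (h : Fin t → S.M) (hp : 0 < S.prob π₀ h) :
    IsSplit (fun m => S.prob π₀ (append h m) / S.prob π₀ h)
      (fun m => S.posterior π₀ (append h m)) (S.posterior π₀ h) := by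
  refine ⟨fun m => div_nonneg (S.prob_nonneg π₀ _) hp.le, fun θ => ?_⟩
  simp_rw [div_mul_eq_mul_div, ← sum_div, prob_mul_posterior, lik_append, ← mul_assoc, ← mul_sum,
    stdSimplex.sum_eq_one, mul_one]
  rw [← prob_mul_posterior, mul_div_cancel_left₀ _ hp.ne']

/-! ### The dynamic programming inequality -/

/-- The news utility collected in the first `n` of `L` communication periods, plus the value
`iterCav N (L - n)` of continuing optimally, in expectation. At `n = L` this is the expected news
utility of the structure, at `n = 0` it is the value of the backward recursion. -/
noncomputable def hybridValue (N : Belief Θ → Belief Θ → ℝ) (L n : ℕ) : ℝ :=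
  ∑ h : Fin n → S.M, S.prob π₀ h *
    ((∑ i : Fin n, N (S.posterior π₀ (pre h (i + 1) i.isLt))
        (S.posterior π₀ (pre h i i.isLt.le)))
      + iterCav N (L - n) (S.posterior π₀ h))

theorem hybridValue_zero (N : Belief Θ → Belief Θ → ℝ) (L : ℕ) :
    S.hybridValue π₀ N L 0 = iterCav N L π₀ := by
  simp [hybridValue, prob_zero, posterior_zero]

theorem expectedNewsUtility_eq_hybridValue (N : Belief Θ → Belief Θ → ℝ) (T : ℕ) :
    S.expectedNewsUtility N T π₀ = S.hybridValue π₀ N (T - 1) (T - 1) := by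
  unfold expectedNewsUtility hybridValue
  rw [sum_comm]
  refine sum_congr rfl fun h _ => ?_
  simp_rw [mul_add, sum_add_distrib, ← sum_mul]
  congr 1
  simp_rw [← prob_mul_posterior, mul_assoc, ← mul_sum]
  rw [Nat.sub_self]
  rfl

theorem hybridValue_succ (N : Belief Θ → Belief Θ → ℝ) {L n : ℕ} :
    S.hybridValue π₀ N L (n + 1) = ∑ h : Fin n → S.M,
      (S.prob π₀ h * (∑ i : Fin n, N (S.posterior π₀ (pre h (i + 1) i.isLt))
          (S.posterior π₀ (pre h i i.isLt.le)))
        + ∑ m, S.prob π₀ (append h m) * (N (S.posterior π₀ (append h m)) (S.posterior π₀ h)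
          + iterCav N (L - (n + 1)) (S.posterior π₀ (append h m)))) := by
  unfold hybridValue
  rw [sum_history_succ]
  refine sum_congr rfl fun h _ => ?_
  rw [← S.sum_prob_append π₀ h, sum_mul, ← sum_add_distrib]
  refine sum_congr rfl fun m _ => ?_
  have hpast : ∀ i : Fin n, N (S.posterior π₀ (pre (append h m) (i.castSucc + 1) i.castSucc.isLt))
      (S.posterior π₀ (pre (append h m) i.castSucc i.castSucc.isLt.le)) =
      N (S.posterior π₀ (pre h (i + 1) i.isLt)) (S.posterior π₀ (pre h i i.isLt.le)) := fun i => by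
    exact congrArg₂ (fun a b => N (S.posterior π₀ a) (S.posterior π₀ b))
      (pre_append h m (i + 1) i.isLt) (pre_append h m i i.isLt.le)
  have hnow : N (S.posterior π₀ (pre (append h m) (Fin.last n + 1) (Fin.last n).isLt))
      (S.posterior π₀ (pre (append h m) (Fin.last n) (Fin.last n).isLt.le)) =
      N (S.posterior π₀ (append h m)) (S.posterior π₀ h) :=
    congrArg₂ (fun a b => N (S.posterior π₀ a) (S.posterior π₀ b))
      (pre_self (append h m)) (pre_append h m n le_rfl)
  rw [Fin.sum_univ_castSucc, hnow, sum_congr rfl fun i _ => hpast i]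
  ring

/-- After any history, the news utility of the next period together with the value of continuing
optimally from there is at most the value given by the backward recursion. -/
theorem stage_le {N : Belief Θ → Belief Θ → ℝ}
    (hN : Continuous fun z : Belief Θ × Belief Θ => N z.1 z.2) (k : ℕ) {n : ℕ} (h : Fin n → S.M) :
    ∑ m, S.prob π₀ (append h m) * (N (S.posterior π₀ (append h m)) (S.posterior π₀ h)
      + iterCav N k (S.posterior π₀ (append h m))) ≤
    S.prob π₀ h * iterCav N (k + 1) (S.posterior π₀ h) := by
  rcases (S.prob_nonneg π₀ h).eq_or_lt with hp | hp
  · have h0 : ∀ m, S.prob π₀ (append h m) = 0 := fun m =>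
      (sum_eq_zero_iff_of_nonneg fun m _ => S.prob_nonneg π₀ _).1
        ((S.sum_prob_append π₀ h).trans hp.symm) m (mem_univ m)
    simp [h0, ← hp]
  · have := (S.isSplit_posterior π₀ h hp).average_le_cav
      (upperSemicontinuous_stage hN k (S.posterior π₀ h))
    simp_rw [div_mul_eq_mul_div, ← sum_div] at this
    rwa [div_le_iff₀' hp] at this

theorem hybridValue_succ_le {N : Belief Θ → Belief Θ → ℝ}
    (hN : Continuous fun z : Belief Θ × Belief Θ => N z.1 z.2) {L n : ℕ} (hn : n < L) :
    S.hybridValue π₀ N L (n + 1) ≤ S.hybridValue π₀ N L n := by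
  rw [hybridValue_succ]
  refine sum_le_sum fun h _ => ?_
  rw [mul_add, show L - n = L - (n + 1) + 1 by omega]
  exact add_le_add_right (S.stage_le π₀ hN _ h) _

theorem expectedNewsUtility_le {N : Belief Θ → Belief Θ → ℝ}
    (hN : Continuous fun z : Belief Θ × Belief Θ => N z.1 z.2) (T : ℕ) :
    S.expectedNewsUtility N T π₀ ≤ Ustar N T 1 π₀ := by
  have key : ∀ n ≤ T - 1, S.hybridValue π₀ N (T - 1) n ≤ S.hybridValue π₀ N (T - 1) 0 := by
    intro n
    induction n with
    | zero => exact fun _ => le_rfl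
    | succ n ih => exact fun hn => (S.hybridValue_succ_le π₀ hN hn).trans (ih (Nat.le_of_succ_le hn))
  rw [expectedNewsUtility_eq_hybridValue]
  exact (key _ le_rfl).trans_eq (S.hybridValue_zero π₀ N _)

/-- Equality in every period yields the value of the backward recursion. -/
theorem expectedNewsUtility_eq {N : Belief Θ → Belief Θ → ℝ} {T : ℕ}
    (heq : ∀ n < T - 1, ∀ h : Fin n → S.M,
      ∑ m, S.prob π₀ (append h m) * (N (S.posterior π₀ (append h m)) (S.posterior π₀ h)
        + iterCav N (T - 1 - (n + 1)) (S.posterior π₀ (append h m))) =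
      S.prob π₀ h * iterCav N (T - 1 - (n + 1) + 1) (S.posterior π₀ h)) :
    S.expectedNewsUtility N T π₀ = Ustar N T 1 π₀ := by
  have key : ∀ n ≤ T - 1, S.hybridValue π₀ N (T - 1) n = S.hybridValue π₀ N (T - 1) 0 := by
    intro n
    induction n with
    | zero => exact fun _ => rfl
    | succ n ih =>
      intro hn
      rw [← ih (Nat.le_of_succ_le hn), hybridValue_succ]
      refine sum_congr rfl fun h _ => ?_
      rw [heq n hn h, mul_add, show T - 1 - n = T - 1 - (n + 1) + 1 by omega]
  rw [expectedNewsUtility_eq_hybridValue]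
  exact (key _ le_rfl).trans (S.hybridValue_zero π₀ N _)

end InfoStructure

/-! ### Information structures that realize prescribed splittings -/

open InfoStructure

variable {Θ : Type*} [Fintype Θ] {K : ℕ}

open Classical in
/-- The message distribution in state `θ` that turns the belief `x` into `q k` with probability
`w k`: message `k` has probability `w k * q k θ / x θ`. In a state of probability zero any
distribution will do; the weights themselves are used. -/
noncomputable def splitMessage {w : Fin K → ℝ} {q : Fin K → Belief Θ} {x : Belief Θ}
    (hs : IsSplit w q x) (θ : Θ) : stdSimplex ℝ (Fin K) :=
  if hx : x θ = 0 then ⟨w, hs.nonneg, hs.sum_eq_one⟩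
  else ⟨fun k => w k * q k θ / x θ,
    fun k => div_nonneg (mul_nonneg (hs.nonneg k) (stdSimplex.zero_le _ _))
      (stdSimplex.zero_le _ _), by
    rw [← sum_div, hs.average, div_self hx]⟩

theorem mul_splitMessage {w : Fin K → ℝ} {q : Fin K → Belief Θ} {x : Belief Θ}
    (hs : IsSplit w q x) (θ : Θ) (k : Fin K) : x θ * splitMessage hs θ k = w k * q k θ := by
  unfold splitMessage
  split_ifs with hx
  · rw [hx, zero_mul]
    refine ((sum_eq_zero_iff_of_nonneg fun k _ => ?_).1 ((hs.average θ).trans hx) k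
      (mem_univ k)).symm
    exact mul_nonneg (hs.nonneg k) (stdSimplex.zero_le _ _)
  · exact mul_div_cancel₀ _ hx

/-- The belief after a history, when message `k` of period `t + 1` moves the belief from `x` to
`Q t x k`. -/
def beliefAt (Q : ℕ → Belief Θ → Fin K → Belief Θ) (π₀ : Belief Θ) :
    (t : ℕ) → (Fin t → Fin K) → Belief Θ
  | 0, _ => π₀
  | t + 1, h => Q t (beliefAt Q π₀ t (pre h t t.le_succ)) (h (Fin.last t))

theorem beliefAt_append (Q : ℕ → Belief Θ → Fin K → Belief Θ) (π₀ : Belief Θ) {t : ℕ}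
    (h : Fin t → Fin K) (m : Fin K) :
    beliefAt Q π₀ (t + 1) (append h m) = Q t (beliefAt Q π₀ t h) m := by
  rw [beliefAt, append_last, pre_append h m t le_rfl, pre_self]

variable {W : ℕ → Belief Θ → Fin K → ℝ} {Q : ℕ → Belief Θ → Fin K → Belief Θ}

/-- The information structure that, at belief `x` in period `t + 1`, splits `x` into the beliefs
`Q t x k` with weights `W t x k`. -/
@[reducible]
noncomputable def splitStructure (hs : ∀ t x, IsSplit (W t x) (Q t x) x) (π₀ : Belief Θ) :
    InfoStructure Θ where
  M := Fin K
  fintypeM := inferInstance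
  σ t h θ := splitMessage (hs t (beliefAt Q π₀ t h)) θ

variable (hs : ∀ t x, IsSplit (W t x) (Q t x) x) (π₀ : Belief Θ)

/-- The induction step for `prior_mul_lik`, the statement that `beliefAt` satisfies Bayes' rule. -/
theorem prob_append_of_prob_mul {t : ℕ} (h : Fin t → Fin K) (m : Fin K)
    (ih : ∀ θ, π₀ θ * (splitStructure hs π₀).lik h θ =
      (splitStructure hs π₀).prob π₀ h * beliefAt Q π₀ t h θ) :
    (∀ θ, π₀ θ * (splitStructure hs π₀).lik (append h m) θ =
      (splitStructure hs π₀).prob π₀ h * W t (beliefAt Q π₀ t h) m *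
        Q t (beliefAt Q π₀ t h) m θ) ∧
    (splitStructure hs π₀).prob π₀ (append h m) =
      (splitStructure hs π₀).prob π₀ h * W t (beliefAt Q π₀ t h) m := by
  have h1 : ∀ θ, π₀ θ * (splitStructure hs π₀).lik (append h m) θ =
      (splitStructure hs π₀).prob π₀ h * W t (beliefAt Q π₀ t h) m *
        Q t (beliefAt Q π₀ t h) m θ := by
    intro θ
    rw [lik_append, ← mul_assoc, ih, mul_assoc, mul_assoc]
    congr 1
    exact mul_splitMessage (hs t (beliefAt Q π₀ t h)) θ m
  refine ⟨h1, ?_⟩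
  unfold prob at h1 ⊢
  simp_rw [h1, ← mul_sum, stdSimplex.sum_eq_one, mul_one]

/-- `beliefAt` satisfies Bayes' rule. Written without division it holds off path too, so the induction
on the history needs no case distinction. -/
theorem prior_mul_lik {t : ℕ} (h : Fin t → Fin K) (θ : Θ) :
    π₀ θ * (splitStructure hs π₀).lik h θ =
      (splitStructure hs π₀).prob π₀ h * beliefAt Q π₀ t h θ := by
  induction t generalizing θ with
  | zero => rw [prob_zero (splitStructure hs π₀) π₀ h]; simp [lik, beliefAt]
  | succ t ih =>
    obtain ⟨g, m, rfl⟩ : ∃ g m, h = append (t := t) g m := ⟨_, _, (append_pre_last h).symm⟩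
    obtain ⟨h1, h2⟩ := prob_append_of_prob_mul hs π₀ g m (ih g)
    rw [h1, beliefAt_append, h2]

theorem prob_append_split {t : ℕ} (h : Fin t → Fin K) (m : Fin K) :
    (splitStructure hs π₀).prob π₀ (append h m) =
      (splitStructure hs π₀).prob π₀ h * W t (beliefAt Q π₀ t h) m :=
  (prob_append_of_prob_mul hs π₀ h m (prior_mul_lik hs π₀ h)).2

theorem posterior_split {t : ℕ} (h : Fin t → Fin K) (hp : 0 < (splitStructure hs π₀).prob π₀ h) :
    (splitStructure hs π₀).posterior π₀ h = beliefAt Q π₀ t h := by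
  refine stdSimplex.ext (funext fun θ => mul_left_cancel₀ hp.ne' ?_)
  rw [prob_mul_posterior, prior_mul_lik]

theorem posterior_append_split {t : ℕ} (h : Fin t → Fin K) (m : Fin K)
    (hp : 0 < (splitStructure hs π₀).prob π₀ h) (hm : W t (beliefAt Q π₀ t h) m ≠ 0) :
    (splitStructure hs π₀).posterior π₀ (append h m) = Q t (beliefAt Q π₀ t h) m := by
  rw [posterior_split hs π₀, beliefAt_append]
  rw [prob_append_split]
  exact mul_pos hp (((hs t _).nonneg m).lt_of_ne' hm)

theorem condProbPosterior_split {t : ℕ} (h : Fin t → Fin K)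
    (hp : 0 < (splitStructure hs π₀).prob π₀ h) (p : Belief Θ) [DecidableEq (Belief Θ)] :
    (splitStructure hs π₀).condProbPosterior π₀ h p =
      ∑ k, if Q t (beliefAt Q π₀ t h) k = p then W t (beliefAt Q π₀ t h) k else 0 := by
  unfold condProbPosterior
  refine sum_congr rfl fun m _ => ?_
  rw [prob_append_split, mul_div_cancel_left₀ _ hp.ne']
  by_cases hm : W t (beliefAt Q π₀ t h) m = 0
  · simp [hm]
  · rw [posterior_append_split hs π₀ h m hp hm]
    congr

theorem sum_prob_append_split {t : ℕ} (h : Fin t → Fin K) (F : Belief Θ → Belief Θ → ℝ) :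
    ∑ m, (splitStructure hs π₀).prob π₀ (append h m) *
      F ((splitStructure hs π₀).posterior π₀ (append h m)) ((splitStructure hs π₀).posterior π₀ h) =
    (splitStructure hs π₀).prob π₀ h * ∑ k, W t ((splitStructure hs π₀).posterior π₀ h) k *
      F (Q t ((splitStructure hs π₀).posterior π₀ h) k)
        ((splitStructure hs π₀).posterior π₀ h) := by
  rw [mul_sum]
  refine sum_congr rfl fun m _ => ?_
  rw [prob_append_split, mul_assoc]
  rcases ((splitStructure hs π₀).prob_nonneg π₀ h).eq_or_lt with hp | hp
  · rw [← hp, zero_mul, zero_mul]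
  · rw [posterior_split hs π₀ h hp]
    by_cases hm : W t (beliefAt Q π₀ t h) m = 0
    · rw [hm, zero_mul, zero_mul]
    · rw [posterior_append_split hs π₀ h m hp hm]

end NewsUtility

open NewsUtility in
open Classical in
theorem proposition2 {Θ : Type*} [Fintype Θ] (hK : 2 ≤ Fintype.card Θ)
    (T : ℕ) (hT : 2 ≤ T)
    (N : Belief Θ → Belief Θ → ℝ) (hN : Continuous fun z : Belief Θ × Belief Θ => N z.1 z.2)
    (π₀ : Belief Θ) (hπ₀ : ∀ θ, 0 < π₀ θ) :
    IsGreatest (Set.range fun S : InfoStructure Θ => S.expectedNewsUtility N T π₀)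
      (Ustar N T 1 π₀) ∧
    ∃ S : InfoStructure Θ, Fintype.card S.M = Fintype.card Θ ∧
      S.expectedNewsUtility N T π₀ = Ustar N T 1 π₀ ∧
      ∀ t : ℕ, 1 ≤ t → t ≤ T - 1 → ∀ h : Fin (t - 1) → S.M, 0 < S.prob π₀ h →
        ∃ (q : Fin (Fintype.card Θ) → Belief Θ) (w : Fin (Fintype.card Θ) → ℝ),
          (∀ k, 0 ≤ w k) ∧ ∑ k, w k = 1 ∧
          (∀ θ, ∑ k, w k * q k θ = S.posterior π₀ h θ) ∧
          (∀ p : Belief Θ, S.condProbPosterior π₀ h p = ∑ k, if q k = p then w k else 0) ∧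
          Ustar N T t (S.posterior π₀ h) = ∑ k, w k * U N T t (q k) (S.posterior π₀ h) := by
  choose w q hs hcav using fun n (x : Belief Θ) =>
    exists_split_eq_cav (upperSemicontinuous_stage hN n x) x
  -- after period `t + 1`, there remain `T - 1 - (t + 1)` communication periods
  have hs' : ∀ t x, IsSplit (w (T - 1 - (t + 1)) x) (q (T - 1 - (t + 1)) x) x := fun t x => hs _ x
  have hval : (splitStructure hs' π₀).expectedNewsUtility N T π₀ = Ustar N T 1 π₀ := by
    refine InfoStructure.expectedNewsUtility_eq _ π₀ fun n _ h => ?_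
    refine (sum_prob_append_split hs' π₀ h
      fun p x => N p x + iterCav N (T - 1 - (n + 1)) p).trans ?_
    exact congrArg _ (hcav _ _).symm
  refine ⟨⟨⟨_, hval⟩, ?_⟩, splitStructure hs' π₀, Fintype.card_fin _, hval, ?_⟩
  · rintro _ ⟨S, rfl⟩
    exact S.expectedNewsUtility_le π₀ hN T
  · intro t ht1 htT h hp
    obtain ⟨s, rfl⟩ : ∃ s, t = s + 1 := ⟨t - 1, by omega⟩
    have hpost := posterior_split hs' π₀ h hp
    refine ⟨_, _, (hs' s _).nonneg, (hs' s (beliefAt _ π₀ s h)).sum_eq_one, fun θ => ?_,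
      fun p => condProbPosterior_split hs' π₀ h hp p, ?_⟩
    · rw [hpost]
      exact (hs' s _).average θ
    · rw [hpost]
      have h1 : T - (s + 1) = T - 1 - (s + 1) + 1 := by omega
      have h2 : T - (s + 1 + 1) = T - 1 - (s + 1) := by omega
      simp only [U, Ustar, h1, h2]
      exact hcav _ _
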